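/- **Theorem.** For a metric space $(X,D)$, a continuous map $F:X\to X$, a closed set $A\subseteq X$ with $F(A)\subseteq A$, and an integer $T\ge 1$, let $D_T(x,y)=\max_{0\le t<T}D(F^t(x),F^t(y))$. For $\varepsilon>0$ let $\mathrm{sep}(A,\varepsilon,D_T)$ be the maximum size of a subset of $A$ whose distinct points satisfy $D_T(x,y)\ge\varepsilon$; let $\mathrm{span}(A,\varepsilon,D_T)$ be the minimum size of a set $S\subseteq A$ such that every $x\in A$ satisfies $D_T(s,x)<\varepsilon$ for some $s\in S$; and let $\mathrm{cov}(A,\varepsilon,D_T)$ be the minimum size of a cover of $A$ by subsets of $A$ in each of which any two points satisfy $D_T(x,y)<\varepsilon$. For compact $A$ these numbers are finite, and the topological entropy is $h(A,F)=\lim_{\varepsilon\to0^+}\limsup_{T\to\infty}\frac{\ln N_T(\varepsilon)}{T}\in[0,\infty]$ for nonempty $A$, where $N_T(\varepsilon)$ is any one of the three numbers (all three give the same value). A system is topologically transitive if it has a dense forward orbit. There exist a metric space $(X,D)$, a map $F:X\to X$ and a subset $W\subseteq X$ with $F(W)\subseteq W$ such that: (i) $X$ and $W$ are compact with respect to $D$,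 and $F:X\to X$ and $F|_W:W\to W$ are homeomorphisms. (ii) For some $\varepsilon>0$, $$\liminf_{T\to\infty}\frac{\ln \mathrm{sep}(X,\varepsilon,D_T)}{T}<\limsup_{T\to\infty}\frac{\ln \mathrm{sep}(X,\varepsilon,D_T)}{T},\qquad \liminf_{T\to\infty}\frac{\ln \mathrm{sep}(W,\varepsilon,D_T)}{T}<\limsup_{T\to\infty}\frac{\ln \mathrm{sep}(W,\varepsilon,D_T)}{T}.$$ (iii) For all $\delta>0$, $$\liminf_{T\to\infty}\frac{\ln \mathrm{span}(W,\delta,D_T)}{T}=\limsup_{T\to\infty}\frac{\ln \mathrm{span}(W,\delta,D_T)}{T}.$$ Specifically, for some $\delta^*$ with $0<\delta^*<\varepsilon$ (the $\varepsilon$ of (ii)): (iiia) if $\delta>\delta^*$, then $\lim_{T\to\infty}\frac{\ln \mathrm{span}(X,\delta,D_T)}{T}=\lim_{T\to\infty}\frac{\ln \mathrm{span}(W,\delta,D_T)}{T}=0$; (iiib) if $0<\delta\le\delta^*$, then $\lim_{T\to\infty}\frac{\ln \mathrm{span}(W,\delta,D_T)}{T}=\ln 2$. (iv) $h(X,F)=\infty$,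 while $h(W,F|_W)=\ln 2$. (v) The system $(X,F)$ is not topologically transitive, while the system $(W,F|_W)$ is topologically transitive. -/

import Mathlib

open Set Filter Topology

noncomputable section

/-- Bowen's distance `D_T(x, y) = max {D(F^t x, F^t y) : 0 ≤ t < T}` (used for `T ≥ 1`). -/
def dynDist {X : Type*} [MetricSpace X] (F : X → X) (T : ℕ) (x y : X) : ℝ :=
  ⨆ t : Fin T, dist (F^[(t : ℕ)] x) (F^[(t : ℕ)] y)

/-- The covering number `cov(A, ε, d)`: the minimum size of a cover of `A` by subsets of `A`, in
each of which any two points are at distance less than `ε` (`⊤` if there is no finite one). -/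
def covNum {X : Type*} (A : Set X) (ε : ℝ) (d : X → X → ℝ) : ℕ∞ :=
  ⨅ (U : Finset (Set X))
    (_ : ⋃₀ (U : Set (Set X)) = A ∧ ∀ V ∈ U, ∀ x ∈ V, ∀ y ∈ V, d x y < ε), (U.card : ℕ∞)

/-- The separation number `sep(A, ε, d)`: the maximum size of a finite subset of `A` whose
distinct points are at distance at least `ε` (`⊤` if the sizes are unbounded). -/
def sepNum {X : Type*} (A : Set X) (ε : ℝ) (d : X → X → ℝ) : ℕ∞ :=
  ⨆ (S : Finset X)
    (_ : (S : Set X) ⊆ A ∧ ∀ x ∈ S, ∀ y ∈ S, x ≠ y → ε ≤ d x y), (S.card : ℕ∞)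

/-- The spanning number `span(A, ε, d)`: the minimum size of a finite subset of `A` such that every
point of `A` is at distance less than `ε` from it (`⊤` if there is none). -/
def spanNum {X : Type*} (A : Set X) (ε : ℝ) (d : X → X → ℝ) : ℕ∞ :=
  ⨅ (S : Finset X)
    (_ : (S : Set X) ⊆ A ∧ ∀ x ∈ A, ∃ s ∈ S, d s x < ε), (S.card : ℕ∞)

/-- `ln cov(A, ε, D_T) / T`, as an extended real number. -/
def covRate {X : Type*} [MetricSpace X] (F : X → X) (A : Set X) (ε : ℝ) (T : ℕ) : EReal :=
  ENNReal.log (covNum A ε (dynDist F T)) / (T : EReal)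

/-- `ln sep(A, ε, D_T) / T`, as an extended real number. -/
def sepRate {X : Type*} [MetricSpace X] (F : X → X) (A : Set X) (ε : ℝ) (T : ℕ) : EReal :=
  ENNReal.log (sepNum A ε (dynDist F T)) / (T : EReal)

/-- `ln span(A, ε, D_T) / T`, as an extended real number. -/
def spanRate {X : Type*} [MetricSpace X] (F : X → X) (A : Set X) (ε : ℝ) (T : ℕ) : EReal :=
  ENNReal.log (spanNum A ε (dynDist F T)) / (T : EReal)

/-- The topological entropy (Bowen, Dinaburg) of `F` on the forward invariant set `A` is `h`:
the limit, as `ε → 0+`, of `limsup_T ln N_T(ε) / T` is `h`, whether `N_T(ε)` is the covering, the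
separation or the spanning number of `A` with respect to `D_T`. -/
def HasTopEntropy {X : Type*} [MetricSpace X] (F : X → X) (A : Set X) (h : EReal) : Prop :=
  Tendsto (fun ε : ℝ => limsup (covRate F A ε) atTop) (𝓝[>] 0) (𝓝 h) ∧
  Tendsto (fun ε : ℝ => limsup (sepRate F A ε) atTop) (𝓝[>] 0) (𝓝 h) ∧
  Tendsto (fun ε : ℝ => limsup (spanRate F A ε) atTop) (𝓝[>] 0) (𝓝 h)

/-- Topological transitivity: there is a dense forward orbit. -/
def IsTopTransitive {Y : Type*} [TopologicalSpace Y] (f : Y → Y) : Prop :=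
  ∃ x : Y, Dense (range fun t : ℕ => f^[t] x)

end

/-! The system is a product. Its first factor is the two-sided full 2-shift, with a metric tailored
to resolution 2; its second is a tower whose level k moves by the k-th power of the shift. The tower
has infinite entropy, destroys transitivity because level 0 is fixed, and has diameter at most 1, so
it is invisible at resolution 2. The set W is the fibre over the zero of the tower.

Under `seqDist` two sequences are at distance 2 exactly when the pair is a limit of prescribed
pairs, the edges. The two sequences of an edge are about to read adjacent letters of a pentagon. A
pentagon has no triangle, so a single reading separates only two letters in seven steps. Doubling
makes non-adjacent letters adjacent, so a word followed by its double separates all five letters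
(Shannon's code for the pentagon). At scale m this yields 5^(4m) separated points in 63m steps
(`le_sepNum_seqFiber`). In time 7M with M = 200^(k+1), the pause between word and double hides the
first copy for scales from M on, and the smaller scales involve few sequences; hence at most 2^(M+1)
separated points (`sepNum_univ_le`). As 2^9 < 5^4, the two rates differ.

Spanning stays regular: the zero sequence is within 1 of every sequence, while distance below 1
forces agreement at coordinate 0, as in an ordinary full shift. -/

section Bowen

/-! ### Bowen's distance -/

variable {X : Type*} [MetricSpace X] {F : X → X} {T : ℕ} {x y : X} {ε : ℝ}

theorem dist_le_dynDist {t : ℕ} (ht : t < T) :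
    dist (F^[t] x) (F^[t] y) ≤ dynDist F T x y :=
  le_ciSup (f := fun t : Fin T => dist (F^[(t : ℕ)] x) (F^[(t : ℕ)] y))
    (Set.finite_range _).bddAbove ⟨t, ht⟩

theorem dynDist_lt_iff (hε : 0 < ε) :
    dynDist F T x y < ε ↔ ∀ t < T, dist (F^[t] x) (F^[t] y) < ε := by
  refine ⟨fun h t ht => (dist_le_dynDist ht).trans_lt h, fun h => ?_⟩
  rcases Nat.eq_zero_or_pos T with rfl | hT
  · simpa [dynDist, Real.iSup_of_isEmpty] using hε
  · have : Nonempty (Fin T) := ⟨⟨0, hT⟩⟩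
    obtain ⟨i, hi⟩ := exists_eq_ciSup_of_finite
      (f := fun t : Fin T => dist (F^[(t : ℕ)] x) (F^[(t : ℕ)] y))
    rw [dynDist, ← hi]
    exact h i i.2

theorem le_dynDist_iff (hε : 0 < ε) :
    ε ≤ dynDist F T x y ↔ ∃ t < T, ε ≤ dist (F^[t] x) (F^[t] y) := by
  rw [← not_lt, dynDist_lt_iff hε]
  push Not
  rfl

end Bowen

/-! ### Comparison of covering, separation and spanning numbers -/

section Numbers

variable {X : Type*} {A B : Set X} {ε : ℝ} {d : X → X → ℝ}

theorem sepNum_mono (h : A ⊆ B) : sepNum A ε d ≤ sepNum B ε d :=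
  iSup_mono fun _ => iSup_mono' fun hS => ⟨⟨hS.1.trans h, hS.2⟩, le_rfl⟩

theorem sepNum_le_covNum : sepNum A ε d ≤ covNum A ε d := by
  refine iSup₂_le fun S hS => le_iInf₂ fun U hU => ?_
  have hmem : ∀ x ∈ S, ∃ V ∈ U, x ∈ V := fun x hx => by
    have : x ∈ ⋃₀ (U : Set (Set X)) := hU.1 ▸ hS.1 hx
    simpa using this
  choose! V hVU hxV using hmem
  refine Nat.cast_le.2 (Finset.card_le_card_of_injOn V hVU fun x hx y hy hxy => ?_)
  by_contra hne
  exact absurd (hU.2 _ (hVU x hx) x (hxV x hx) y (hxy ▸ hxV y hy))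
    (not_lt.2 (hS.2 x hx y hy hne))

theorem spanNum_le_covNum : spanNum A ε d ≤ covNum A ε d := by
  classical
  refine le_iInf₂ fun U hU => ?_
  rcases isEmpty_or_nonempty X with hX | ⟨⟨x₀⟩⟩
  · refine (iInf₂_le ∅ ⟨by simp, fun x => hX.elim x⟩).trans (by simp)
  have hpt : ∀ V : Set X, ∃ s, V.Nonempty → s ∈ V := fun V => by
    by_cases h : V.Nonempty
    · exact ⟨h.some, fun _ => h.some_mem⟩
    · exact ⟨x₀, fun h' => absurd h' h⟩
  choose s hs using hpt
  -- An empty member of the cover is discarded: its default point may lie outside `A`.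
  refine (iInf₂_le ((U.filter Set.Nonempty).image s) ⟨?_, fun x hx => ?_⟩).trans
    (Nat.cast_le.2 (Finset.card_image_le.trans (Finset.card_filter_le _ _)))
  · intro z hz
    simp only [Finset.coe_image, Finset.coe_filter, mem_image, mem_ofPred_eq] at hz
    obtain ⟨V, ⟨hV, hne⟩, rfl⟩ := hz
    exact hU.1 ▸ mem_sUnion.2 ⟨V, hV, hs V hne⟩
  · rw [← hU.1] at hx
    obtain ⟨V, hV, hxV⟩ := hx
    exact ⟨s V, Finset.mem_image_of_mem _ (Finset.mem_filter.2 ⟨hV, x, hxV⟩),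
      hU.2 V hV _ (hs V ⟨x, hxV⟩) _ hxV⟩

/-- A classifying map into a finite type bounds the covering number. -/
theorem covNum_le_card {κ : Type*} [Fintype κ] (φ : X → κ)
    (h : ∀ x ∈ A, ∀ y ∈ A, φ x = φ y → d x y < ε) : covNum A ε d ≤ (Fintype.card κ : ℕ∞) := by
  classical
  refine (iInf₂_le (Finset.univ.image fun k => A ∩ φ ⁻¹' {k}) ⟨?_, ?_⟩).trans
    (Nat.cast_le.2 Finset.card_image_le)
  · ext x
    simp
  · intro V hV x hx y hy
    simp only [Finset.mem_image, Finset.mem_univ, true_and] at hV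
    obtain ⟨k, rfl⟩ := hV
    exact h x hx.1 y hy.1 (hx.2.trans hy.2.symm)

theorem card_le_sepNum {ι : Type*} [Fintype ι] (p : ι → X) (hp : ∀ i, p i ∈ A)
    (hinj : Function.Injective p) (h : ∀ i j, i ≠ j → ε ≤ d (p i) (p j)) :
    (Fintype.card ι : ℕ∞) ≤ sepNum A ε d := by
  classical
  refine le_trans ?_ (le_iSup₂ (Finset.univ.image p) ⟨?_, ?_⟩)
  · rw [Finset.card_image_of_injective _ hinj, Finset.card_univ]
  · intro z hz
    simp only [Finset.coe_image, Finset.coe_univ, image_univ, mem_range] at hz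
    obtain ⟨i, rfl⟩ := hz
    exact hp i
  · intro x hx y hy hxy
    simp only [Finset.mem_image, Finset.mem_univ, true_and] at hx hy
    obtain ⟨i, rfl⟩ := hx
    obtain ⟨j, rfl⟩ := hy
    exact h i j fun hij => hxy (hij ▸ rfl)

theorem card_le_spanNum {ι : Type*} [Fintype ι] (p : ι → X) (hp : ∀ i, p i ∈ A)
    (h : ∀ s i j, d s (p i) < ε → d s (p j) < ε → i = j) :
    (Fintype.card ι : ℕ∞) ≤ spanNum A ε d := by
  refine le_iInf₂ fun S hS => Nat.cast_le.2 ?_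
  choose s hsS hs using fun i => hS.2 (p i) (hp i)
  rw [← Finset.card_univ]
  exact Finset.card_le_card_of_injOn s (fun i _ => hsS i)
    fun i _ j _ hij => h (s i) i j (hs i) (by rw [hij]; exact hs j)

/-- The hypothesis of `card_le_spanNum`, tested on the points themselves, also makes them separated;
one fact about words thus serves both numbers. -/
theorem card_le_sepNum_of_span {ι : Type*} [Fintype ι] (p : ι → X) (hp : ∀ i, p i ∈ A)
    (hd : ∀ x, d x x < ε) (h : ∀ s i j, d s (p i) < ε → d s (p j) < ε → i = j) :
    (Fintype.card ι : ℕ∞) ≤ sepNum A ε d := by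
  refine card_le_sepNum p hp (fun i j hij => h (p i) i j (hd _) (hij ▸ hd _)) fun i j hij => ?_
  by_contra hlt
  exact hij (h (p i) i j (hd _) (not_le.1 hlt))

theorem spanNum_eq_one {c : X} (hc : c ∈ A) (h : ∀ x ∈ A, d c x < ε) : spanNum A ε d = 1 := by
  refine le_antisymm ((iInf₂_le {c} ⟨by simpa using hc, fun x hx =>
    ⟨c, by simp, h x hx⟩⟩).trans (by simp)) (le_iInf₂ fun S hS => ?_)
  obtain ⟨s, hs, -⟩ := hS.2 c hc
  exact_mod_cast Finset.card_pos.2 ⟨s, hs⟩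

end Numbers

/-! ### Exponential growth rates -/

section Rates

theorem log_natCast_div (N T : ℕ) (hN : 0 < N) :
    ENNReal.log (((N : ℕ∞) : ENNReal)) / (T : EReal) = ((Real.log N / T : ℝ) : EReal) := by
  have h1 : (((N : ℕ∞) : ENNReal)) = ENNReal.ofReal (N : ℝ) := by simp
  rw [h1, ENNReal.log_ofReal_of_pos (by exact_mod_cast hN), EReal.coe_div]
  rfl

theorem log_div_mono {a b : ℕ∞} (h : a ≤ b) (T : ℕ) :
    ENNReal.log (a : ENNReal) / (T : EReal) ≤ ENNReal.log (b : ENNReal) / (T : EReal) :=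
  EReal.div_le_div_right_of_nonneg (by positivity)
    (ENNReal.log_monotone (ENat.toENNReal_le.2 h))

theorem le_log_div {a : ℕ∞} {N T : ℕ} (hN : 0 < N) (h : (N : ℕ∞) ≤ a) :
    ((Real.log N / T : ℝ) : EReal) ≤ ENNReal.log (a : ENNReal) / (T : EReal) :=
  log_natCast_div N T hN ▸ log_div_mono h T

theorem log_div_le {a : ℕ∞} {N T : ℕ} (hN : 0 < N) (h : a ≤ (N : ℕ∞)) :
    ENNReal.log (a : ENNReal) / (T : EReal) ≤ ((Real.log N / T : ℝ) : EReal) :=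
  log_natCast_div N T hN ▸ log_div_mono h T

theorem tendsto_add_mul_log_two_div (c : ℕ) :
    Tendsto (fun T : ℕ => ((Real.log ((2 ^ (T + c) : ℕ) : ℝ) / T : ℝ) : EReal)) atTop
      (𝓝 ((Real.log 2 : ℝ) : EReal)) := by
  refine (continuous_coe_real_ereal.tendsto _).comp ?_
  have h : Tendsto (fun T : ℕ => Real.log 2 + c * Real.log 2 / (T : ℝ)) atTop
      (𝓝 (Real.log 2 + 0)) :=
    tendsto_const_nhds.add (tendsto_const_div_atTop_nhds_zero_nat _)
  rw [add_zero] at h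
  refine h.congr' ?_
  filter_upwards [eventually_gt_atTop 0] with T hT
  have : (T : ℝ) ≠ 0 := by positivity
  push_cast
  rw [Real.log_pow]
  push_cast
  field_simp

theorem tendsto_log_div_of_two_pow {N : ℕ → ℕ∞} (c : ℕ) (h1 : ∀ T, ((2 ^ T : ℕ) : ℕ∞) ≤ N T)
    (h2 : ∀ T, N T ≤ ((2 ^ (T + c) : ℕ) : ℕ∞)) :
    Tendsto (fun T : ℕ => ENNReal.log (N T : ENNReal) / (T : EReal)) atTop
      (𝓝 ((Real.log 2 : ℝ) : EReal)) :=
  tendsto_of_tendsto_of_tendsto_of_le_of_le (tendsto_add_mul_log_two_div 0)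
    (tendsto_add_mul_log_two_div c) (fun T => le_log_div (by positivity) (h1 T))
    (fun T => log_div_le (by positivity) (h2 T))

theorem le_limsup_log_div {N : ℕ → ℕ∞} (n : ℕ) (h : ∀ T, ((2 ^ (n * T) : ℕ) : ℕ∞) ≤ N T) :
    ((n * Real.log 2 : ℝ) : EReal) ≤
      limsup (fun T : ℕ => ENNReal.log (N T : ENNReal) / (T : EReal)) atTop := by
  refine le_limsup_of_frequently_le (Eventually.frequently ?_)
  filter_upwards [eventually_gt_atTop 0] with T hT
  have hT' : (T : ℝ) ≠ 0 := by positivity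
  have : n * Real.log 2 = Real.log ((2 ^ (n * T) : ℕ) : ℝ) / T := by
    push_cast
    rw [Real.log_pow]
    push_cast
    field_simp
  exact this ▸ le_log_div (by positivity) (h T)

end Rates

/-! ### Ultrametrics from exhaustions; product topologies -/

noncomputable section

section LevelDist

variable {ι : Type*}

open Classical in
/-- The sequence of restrictions of `x` to the sets `A n`. -/
def levels (A : ℕ → Set ι) (x : ι → Bool) : ℕ → ι → Bool := fun n i => decide (i ∈ A n) && x i

/-- The ultrametric on binary families given by the exhaustion `A` of the index set:
`levelDist A x y = 2⁻ⁿ` for the first `n` such that `x` and `y` differ on `A n`. -/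
def levelDist (A : ℕ → Set ι) (x y : ι → Bool) : ℝ :=
  (PiNat.dist (E := fun _ => ι → Bool)).dist (levels A x) (levels A y)

variable {A : ℕ → Set ι} {x y z : ι → Bool}

theorem levels_eq_iff {n : ℕ} : levels A x n = levels A y n ↔ EqOn x y (A n) := by
  constructor
  · intro h i hi
    simpa [levels, hi] using congrFun h i
  · intro h
    funext i
    by_cases hi : i ∈ A n
    · simp [levels, hi, h hi]
    · simp [levels, hi]

theorem levelDist_self : levelDist A x x = 0 := PiNat.dist_self _

theorem levelDist_comm : levelDist A x y = levelDist A y x := PiNat.dist_comm _ _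

theorem levelDist_nonneg : 0 ≤ levelDist A x y := PiNat.dist_nonneg _ _

theorem levelDist_le_one : levelDist A x y ≤ 1 := PiNat.dist_le_one _ _

theorem levelDist_triangle : levelDist A x z ≤ levelDist A x y + levelDist A y z :=
  PiNat.dist_triangle _ _ _

theorem levelDist_le_pow_iff (hA : Monotone A) {n : ℕ} :
    levelDist A x y ≤ (1 / 2) ^ (n + 1) ↔ EqOn x y (A n) := by
  rw [levelDist, PiNat.dist_comm]
  refine PiNat.mem_cylinder_iff_dist_le.symm.trans ?_
  rw [PiNat.mem_cylinder_iff]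
  refine ⟨fun h => levels_eq_iff.1 (h n n.lt_succ_self).symm, fun h k hk => ?_⟩
  exact levels_eq_iff.2 (h.symm.mono (hA (Nat.lt_succ_iff.1 hk)))

theorem eqOn_of_levelDist_lt {n : ℕ} (h : levelDist A x y < (1 / 2) ^ n) : EqOn x y (A n) :=
  levels_eq_iff.1 (PiNat.apply_eq_of_dist_lt h le_rfl)

theorem levelDist_lt_one_iff (hA : Monotone A) : levelDist A x y < 1 ↔ EqOn x y (A 0) := by
  refine ⟨fun h => eqOn_of_levelDist_lt (by simpa using h), fun h => ?_⟩
  exact ((levelDist_le_pow_iff hA).2 h).trans_lt (by norm_num)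

theorem eq_of_levelDist_eq_zero (hA' : ⋃ n, A n = univ) (h : levelDist A x y = 0) : x = y := by
  funext i
  obtain ⟨n, hn⟩ := mem_iUnion.1 (hA' ▸ mem_univ i)
  exact eqOn_of_levelDist_lt (n := n) (h ▸ by positivity) hn

end LevelDist

/-- A metric space carried by a copy of `ι → Bool` is homeomorphic to it if closeness in the metric
is implied by agreement on a finite set of indices. -/
def homeoOfFiniteAgreement {ι Z : Type*} [MetricSpace Z] (e : (ι → Bool) ≃ Z)
    (h : ∀ ε : ℝ, 0 < ε → ∃ s : Set ι, s.Finite ∧ ∀ x y, EqOn x y s → dist (e x) (e y) < ε) :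
    (ι → Bool) ≃ₜ Z :=
  Continuous.homeoOfEquivCompactToT2 (f := e) <| by
    rw [continuous_iff_continuousAt]
    intro x
    rw [ContinuousAt, Metric.tendsto_nhds]
    intro ε hε
    obtain ⟨s, hs, hd⟩ := h ε hε
    have : ∀ᶠ y in 𝓝 x, ∀ i ∈ s, y i = x i :=
      (eventually_all_finite hs).2 fun i _ =>
        (continuous_apply (A := fun _ => Bool) i).continuousAt.eventually
          (p := fun b => b = x i) (by simp [nhds_discrete])
    filter_upwards [this] with y hy
    exact hd _ _ fun i hi => hy i hi

theorem isHomeomorph_conj {P Z : Type*} [TopologicalSpace P] [TopologicalSpace Z] (e : P ≃ₜ Z)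
    (g : P ≃ₜ P) {f : Z → Z} (h : ∀ x, f (e x) = e (g x)) : IsHomeomorph f := by
  have : f = (e.symm.trans (g.trans e)) := by
    funext z
    obtain ⟨x, rfl⟩ := e.surjective z
    simp [h]
  exact this ▸ Homeomorph.isHomeomorph _

/-- The homeomorphism of `ι → Bool` given by a permutation of the indices. -/
def reindexHomeo {ι : Type*} (σ : Equiv.Perm ι) : (ι → Bool) ≃ₜ (ι → Bool) where
  toFun x i := x (σ i)
  invFun x i := x (σ.symm i)
  left_inv x := by simp
  right_inv x := by simp
  continuous_toFun := by fun_prop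
  continuous_invFun := by fun_prop

end

/-! ### Pentagon code and non-overlapping codewords -/

noncomputable section

section Codewords

/-- Five binary words of length 7, none of which can overlap another one properly: each starts
with `11`, and `11` occurs nowhere else. -/
def codeword (a : ZMod 5) (j : ℤ) : Bool :=
  decide (j = 0 ∨ j = 1 ∨ (j = 3 ∧ (a = 1 ∨ a = 4)) ∨ (j = 4 ∧ a = 2) ∨
    (j = 5 ∧ (a = 3 ∨ a = 4)))

/-- Adjacency in the pentagon. -/
def PentagonAdj (a b : ZMod 5) : Prop := a - b = 1 ∨ b - a = 1

instance : DecidableRel PentagonAdj := fun _ _ => inferInstanceAs (Decidable (_ ∨ _))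

/-- The codeword of `a` occurs in `x` at position `t`. -/
def ReadsAt (x : ℤ → Bool) (t : ℤ) (a : ZMod 5) : Prop :=
  ∀ j, 0 ≤ j → j < 7 → x (t + j) = codeword a j

theorem PentagonAdj.symm {a b : ZMod 5} (h : PentagonAdj a b) : PentagonAdj b a := Or.symm h

theorem PentagonAdj.ne {a b : ZMod 5} (h : PentagonAdj a b) : a ≠ b := by
  revert a b; decide

theorem pentagon_triangle_free {a b c : ZMod 5} (hab : PentagonAdj a b) (hac : PentagonAdj a c) :
    ¬ PentagonAdj b c := by
  revert a b c; decide

/-- Doubling carries the complement of the pentagon, the pentagram, onto the pentagon. Hence the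
pairs (a, 2a) tell all five letters apart. -/
theorem pentagonAdj_or_double {a b : ZMod 5} (h : a ≠ b) :
    PentagonAdj a b ∨ PentagonAdj (2 * a) (2 * b) := by
  revert a b; decide

theorem codeword_injective {a b : ZMod 5}
    (h : ∀ j : ℤ, 0 ≤ j → j < 7 → codeword a j = codeword b j) : a = b := by
  have h3 := h 3 (by norm_num) (by norm_num)
  have h4 := h 4 (by norm_num) (by norm_num)
  have h5 := h 5 (by norm_num) (by norm_num)
  clear h
  revert a b
  decide

theorem ReadsAt.eq {x : ℤ → Bool} {t : ℤ} {a b : ZMod 5} (ha : ReadsAt x t a)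
    (hb : ReadsAt x t b) : a = b :=
  codeword_injective fun j h0 h7 => (ha j h0 h7).symm.trans (hb j h0 h7)

theorem ReadsAt.congr {x y : ℤ → Bool} {t : ℤ} {a : ZMod 5} (h : ReadsAt x t a)
    (hxy : ∀ j, t ≤ j → j < t + 7 → x j = y j) : ReadsAt y t a :=
  fun j h0 h7 => hxy (t + j) (by omega) (by omega) ▸ h j h0 h7

theorem ReadsAt.add_seven_le {x : ℤ → Bool} {s t : ℤ} {a b : ZMod 5} (ha : ReadsAt x s a)
    (hb : ReadsAt x t b) (h : s < t) : s + 7 ≤ t := by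
  by_contra! hlt
  have key : ∀ (c : ZMod 5) (j : ℤ), 1 ≤ j → j ≤ 5 →
      ¬ (codeword c j = true ∧ codeword c (j + 1) = true) := by
    intro c j h1 h5
    interval_cases j <;> revert c <;> decide
  have key6 : ∀ c : ZMod 5, codeword c 6 = false := by decide
  have hb0 : x t = true := by simpa [codeword] using hb 0 (by norm_num) (by norm_num)
  have hb1 : x (t + 1) = true := by simpa [codeword] using hb 1 (by norm_num) (by norm_num)
  have ha0 := ha (t - s) (by omega) (by omega)
  rw [add_sub_cancel, hb0] at ha0
  -- At an offset below 6 the second word would put `11` inside the first; at offset 6 its initial 1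
  -- would meet the final 0.
  rcases lt_or_ge (t - s) 6 with h6 | h6
  · have ha1 := ha (t - s + 1) (by omega) (by omega)
    rw [show s + (t - s + 1) = t + 1 by ring, hb1] at ha1
    exact key a _ (by omega) (by omega) ⟨ha0.symm, ha1.symm⟩
  · rw [show t - s = 6 by omega, key6] at ha0
    exact absurd ha0 (by simp)

/-- A set of sequences any two of which read adjacent codewords when they first separate has at
most two branches in every seven steps. -/
theorem card_le_two_pow_of_branching (r s T : ℕ) (hT : T ≤ s + 7 * r) (K : Finset (ℤ → Bool))
    (h : ∀ x ∈ K, ∀ y ∈ K, x ≠ y → ∃ t : ℕ, s ≤ t ∧ t < T ∧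
      (∀ j : ℤ, 0 ≤ j → j < t → x j = y j) ∧
      ∃ a b, PentagonAdj a b ∧ ReadsAt x t a ∧ ReadsAt y t b) : K.card ≤ 2 ^ r := by
  classical
  induction r generalizing s K with
  | zero =>
    refine (Finset.card_le_one.2 fun x hx y hy => ?_).trans_eq (pow_zero 2).symm
    by_contra hne
    obtain ⟨t, h1, h2, -⟩ := h x hx y hy hne
    omega
  | succ r ih =>
    -- The branching is analysed at the earliest time at which any two members of `K` separate.
    by_cases hex : ∃ t : ℕ, s ≤ t ∧ ∃ x ∈ K, ∃ y ∈ K, t < T ∧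
        (∀ j : ℤ, 0 ≤ j → j < t → x j = y j) ∧
        ∃ a b, PentagonAdj a b ∧ ReadsAt x t a ∧ ReadsAt y t b
    swap
    · refine (Finset.card_le_one.2 fun x hx y hy => ?_).trans Nat.one_le_two_pow
      by_contra hne
      obtain ⟨t, h1, h2⟩ := h x hx y hy hne
      exact hex ⟨t, h1, x, hx, y, hy, h2⟩
    obtain ⟨hst, x, hx, y, hy, htT, -, a, b, hab, hxa, hyb⟩ := Nat.find_spec hex
    have hmin : ∀ z ∈ K, ∀ z' ∈ K, z ≠ z' → ∃ t : ℕ, Nat.find hex ≤ t ∧ t < T ∧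
        (∀ j : ℤ, 0 ≤ j → j < t → z j = z' j) ∧
        ∃ a b, PentagonAdj a b ∧ ReadsAt z t a ∧ ReadsAt z' t b := by
      intro z hz z' hz' hne
      obtain ⟨t, h1, h2⟩ := h z hz z' hz' hne
      exact ⟨t, Nat.find_min' hex ⟨h1, z, hz, z', hz', h2⟩, h2⟩
    generalize Nat.find hex = t₀ at *
    -- A pair that separates after `t₀` does so at least seven steps later, because codewords do not
    -- overlap; so both members read the same codeword at `t₀`.
    have hcompare : ∀ z ∈ K, ∀ c, ReadsAt z t₀ c → ∀ z' ∈ K, z ≠ z' →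
        (∃ c', ReadsAt z' t₀ c' ∧ PentagonAdj c c') ∨ (ReadsAt z' t₀ c ∧
        ∃ t : ℕ, t₀ + 7 ≤ t ∧ t < T ∧ (∀ j : ℤ, 0 ≤ j → j < t → z j = z' j) ∧
        ∃ a b, PentagonAdj a b ∧ ReadsAt z t a ∧ ReadsAt z' t b) := by
      intro z hz c hc z' hz' hne
      obtain ⟨t, h1, h2, h3, u, v, huv, hu, hv⟩ := hmin z hz z' hz' hne
      rcases h1.eq_or_lt with rfl | h1
      · exact Or.inl ⟨v, hv, hc.eq hu ▸ huv⟩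
      · have h7 := hc.add_seven_le hu (by exact_mod_cast h1)
        exact Or.inr ⟨hc.congr fun j hj1 hj2 => h3 j (by omega) (by omega),
          t, by omega, h2, h3, u, v, huv, hu, hv⟩
    -- A third codeword at `t₀` would be adjacent to both `a` and `b`, forming a triangle.
    have hread : ∀ z ∈ K, ReadsAt z t₀ a ∨ ReadsAt z t₀ b := by
      intro z hz
      by_cases hxz : x = z
      · exact Or.inl (hxz ▸ hxa)
      by_cases hyz : y = z
      · exact Or.inr (hyz ▸ hyb)
      rcases hcompare x hx a hxa z hz hxz with ⟨c, hc, hac⟩ | ⟨hc, -⟩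
      · rcases hcompare y hy b hyb z hz hyz with ⟨c', hc', hbc⟩ | ⟨hc', -⟩
        · exact absurd (hc.eq hc' ▸ hbc) (pentagon_triangle_free hab hac)
        · exact Or.inr hc'
      · exact Or.inl hc
    have hclass : ∀ c, (K.filter fun z => ReadsAt z t₀ c).card ≤ 2 ^ r := by
      intro c
      refine ih (t₀ + 7) (by omega) _ fun z hz z' hz' hne => ?_
      rw [Finset.mem_filter] at hz hz'
      rcases hcompare z hz.1 c hz.2 z' hz'.1 hne with ⟨c', hc', hcc⟩ | ⟨-, h'⟩
      · exact absurd (hz'.2.eq hc') hcc.ne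
      · exact h'
    calc K.card ≤ ((K.filter fun z => ReadsAt z t₀ a) ∪ K.filter fun z => ReadsAt z t₀ b).card :=
          Finset.card_le_card fun z hz => by
            rw [Finset.mem_union, Finset.mem_filter, Finset.mem_filter]
            exact (hread z hz).imp (⟨hz, ·⟩) (⟨hz, ·⟩)
      _ ≤ 2 ^ r + 2 ^ r := (Finset.card_union_le _ _).trans (add_le_add (hclass a) (hclass b))
      _ = 2 ^ (r + 1) := by ring

end Codewords

/-! ### Block sequences and the edges between them -/

section Blocks

/-- The shift by `p` places. -/
def shiftBy (p : ℤ) (x : ℤ → Bool) : ℤ → Bool := fun i => x (i + p)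

/-- The sequence that spells out `4 m` letters, pauses for `7 m` steps, spells out the doubles of
the same letters, and vanishes elsewhere. -/
def blockSeq (m : ℕ) (w : ℕ → ZMod 5) : ℤ → Bool := fun i =>
  if 0 ≤ i ∧ i < 28 * m then codeword (w (i / 7).toNat) (i % 7)
  else if 35 * m ≤ i ∧ i < 63 * m then codeword (2 * w ((i - 35 * m) / 7).toNat) ((i - 35 * m) % 7)
  else false

/-- The pairs of shifted block sequences that are to be at distance 2: both are about to spell out
the first letter in which they differ, or its double, and these letters are adjacent. -/
def BlockEdge (m : ℕ) (a b : ℤ → Bool) : Prop :=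
  ∃ (w w' : ℕ → ZMod 5) (i p : ℕ), i < 4 * m ∧ (∀ j < i, w j = w' j) ∧
    (p = 7 * i ∧ PentagonAdj (w i) (w' i) ∨
      p = 35 * m + 7 * i ∧ PentagonAdj (2 * w i) (2 * w' i)) ∧
    a = shiftBy p (blockSeq m w) ∧ b = shiftBy p (blockSeq m w')

variable {m : ℕ} {a b : ℤ → Bool}

theorem BlockEdge.symm (h : BlockEdge m a b) : BlockEdge m b a := by
  obtain ⟨w, w', i, p, hi, hw, hp, ha, hb⟩ := h
  exact ⟨w', w, i, p, hi, fun j hj => (hw j hj).symm,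
    hp.imp (And.imp_right .symm) (And.imp_right .symm), hb, ha⟩

theorem blockSeq_eq_false (w : ℕ → ZMod 5) {i : ℤ} (h : i < 0 ∨ 63 * m ≤ i) :
    blockSeq m w i = false := by
  rw [blockSeq, if_neg (by omega), if_neg (by omega)]

theorem readsAt_blockSeq (w : ℕ → ZMod 5) {i : ℕ} (hi : i < 4 * m) :
    ReadsAt (blockSeq m w) (7 * i : ℕ) (w i) := by
  intro j h0 h7
  rw [blockSeq, if_pos (by omega), show ((7 * i : ℕ) + j) / 7 = (i : ℤ) by omega,
    show ((7 * i : ℕ) + j) % 7 = j by omega, Int.toNat_natCast]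

theorem readsAt_blockSeq_double (w : ℕ → ZMod 5) {i : ℕ} (hi : i < 4 * m) :
    ReadsAt (blockSeq m w) (35 * m + 7 * i : ℕ) (2 * w i) := by
  intro j h0 h7
  rw [blockSeq, if_neg (by omega), if_pos (by omega),
    show ((35 * m + 7 * i : ℕ) + j - 35 * m) / 7 = (i : ℤ) by omega,
    show ((35 * m + 7 * i : ℕ) + j - 35 * m) % 7 = j by omega, Int.toNat_natCast]

theorem ReadsAt.shiftBy {x : ℤ → Bool} {p : ℤ} {c : ZMod 5} (h : ReadsAt x p c) :
    ReadsAt (shiftBy p x) 0 c := fun j h0 h7 => by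
  rw [← h j h0 h7, _root_.shiftBy, zero_add, add_comm]

theorem BlockEdge.readsAt (h : BlockEdge m a b) :
    ∃ u v, PentagonAdj u v ∧ ReadsAt a 0 u ∧ ReadsAt b 0 v := by
  obtain ⟨w, w', i, p, hi, -, ⟨rfl, hadj⟩ | ⟨rfl, hadj⟩, rfl, rfl⟩ := h
  · exact ⟨_, _, hadj, (readsAt_blockSeq w hi).shiftBy, (readsAt_blockSeq w' hi).shiftBy⟩
  · exact ⟨_, _, hadj, (readsAt_blockSeq_double w hi).shiftBy,
      (readsAt_blockSeq_double w' hi).shiftBy⟩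

/-- During the first spelling the past holds only common letters. During the second, the pause of
length 7m keeps the whole first copy out of the last 7m places. -/
theorem BlockEdge.eq_of_neg (h : BlockEdge m a b) {j : ℤ} (h1 : -(7 * m) ≤ j) (h2 : j < 0) :
    a j = b j := by
  obtain ⟨w, w', i, p, hi, hw, hp, rfl, rfl⟩ := h
  rw [shiftBy, shiftBy, blockSeq, blockSeq]
  rcases hp with ⟨rfl, -⟩ | ⟨rfl, -⟩
  · split_ifs
    · rw [hw _ (by omega)]
    · omega
    · rfl
  · split_ifs
    · omega
    · rw [hw _ (by omega)]
    · rfl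

theorem BlockEdge.eq_false (h : BlockEdge m a b) {j : ℤ} (hj : j < -(63 * m) ∨ 63 * m ≤ j) :
    a j = false := by
  obtain ⟨w, w', i, p, hi, -, hp, rfl, rfl⟩ := h
  exact blockSeq_eq_false w (by omega)

theorem exists_blockEdge {w w' : ℕ → ZMod 5} (h : ∃ i < 4 * m, w i ≠ w' i) :
    ∃ p < 63 * m, BlockEdge m (shiftBy (p : ℕ) (blockSeq m w)) (shiftBy (p : ℕ) (blockSeq m w')) := by
  classical
  obtain ⟨hi, hne⟩ := Nat.find_spec h
  have hmin : ∀ j < Nat.find h, w j = w' j := fun j hj => by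
    by_contra hj'
    exact Nat.find_min h hj ⟨by omega, hj'⟩
  rcases pentagonAdj_or_double hne with hadj | hadj
  · exact ⟨7 * Nat.find h, by omega, w, w', _, _, hi, hmin, Or.inl ⟨rfl, hadj⟩, rfl, rfl⟩
  · exact ⟨35 * m + 7 * Nat.find h, by omega, w, w', _, _, hi, hmin, Or.inr ⟨rfl, hadj⟩, rfl, rfl⟩

/-- A set of sequences any two of which come close, within `7 * M` steps, to a pair of block
sequences that belong to scales outside the interval from `m` to `M`, is small. -/
theorem card_le_of_blockEdges (m M : ℕ) (K : Finset (ℤ → Bool))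
    (h : ∀ x ∈ K, ∀ y ∈ K, x ≠ y → ∃ t < 7 * M, ∃ n a b, (n ≤ m ∨ M ≤ n) ∧ BlockEdge n a b ∧
      EqOn (shiftBy (t : ℕ) x) a (Ico (-(7 * M + 7)) (7 * M + 7)) ∧
      EqOn (shiftBy (t : ℕ) y) b (Ico (-(7 * M + 7)) (7 * M + 7))) :
    K.card ≤ 7 * M * 2 ^ (126 * m) + 2 ^ M := by
  classical
  have hshift : ∀ (x : ℤ → Bool) (t : ℕ) (j : ℤ), x j = shiftBy t x (j - t) := fun x t j => by
    rw [shiftBy, sub_add_cancel]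
  have hreads : ∀ {x a : ℤ → Bool} {t : ℕ} {c},
      EqOn (shiftBy t x) a (Ico (-(7 * M + 7)) (7 * M + 7)) → ReadsAt a 0 c → ReadsAt x t c := by
    intro x a t c hxa hc j h0 h7
    rw [hshift x t, add_sub_cancel_left, hxa ⟨by omega, by omega⟩, ← hc j h0 h7, zero_add]
  -- Sequences that come close to a small scale are counted by the time of the approach and 126m
  -- bits; all others separate through scales from `M` on and obey the branching bound.
  let P : (ℤ → Bool) → Prop := fun x => ∃ t < 7 * M, ∃ c : ℤ → Bool,
    (∀ j : ℤ, j < -(63 * m) ∨ 63 * m ≤ j → c j = false) ∧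
    EqOn (shiftBy (t : ℕ) x) c (Ico (-(7 * M + 7)) (7 * M + 7))
  rw [← Finset.card_filter_add_card_filter_not P]
  refine add_le_add ?_ ?_
  · have hP : ∀ x ∈ K.filter P, P x := fun x hx => (Finset.mem_filter.1 hx).2
    choose! t ht c hc hxc using hP
    suffices (K.filter P).card ≤
        (Finset.range (7 * M) ×ˢ (Finset.univ : Finset (Fin (126 * m) → Bool))).card by
      simpa using this
    refine Finset.card_le_card_of_injOn
      (fun x => (t x, fun i : Fin (126 * m) => c x ((i : ℤ) - 63 * m)))
      (fun x hx => by simpa using ht x hx) fun x hx y hy hxy => ?_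
    simp only [Prod.mk.injEq] at hxy
    obtain ⟨htt, hcc⟩ := hxy
    have hcc' : ∀ j, c x j = c y j := by
      intro j
      by_cases hj : j < -(63 * m) ∨ 63 * m ≤ j
      · rw [hc x hx j hj, hc y hy j hj]
      · have := congrFun hcc ⟨(j + 63 * m).toNat, by omega⟩
        simp only at this
        rwa [Int.toNat_of_nonneg (by omega), add_sub_cancel_right] at this
    have htx := ht x hx
    -- With equal times and bits, `x` and `y` agree throughout [0, 7M + 7), so they cannot read
    -- different codewords at a time below 7M.
    by_contra hne
    obtain ⟨s, hs, n, a, b, -, he, hxa, hyb⟩ :=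
      h x (Finset.mem_filter.1 hx).1 y (Finset.mem_filter.1 hy).1 hne
    obtain ⟨u, v, huv, hu, hv⟩ := he.readsAt
    refine huv.ne (((hreads hxa hu).congr fun j h1 h2 => ?_).eq (hreads hyb hv))
    rw [hshift x (t x), hshift y (t y), hxc x hx ⟨by omega, by omega⟩,
      hxc y hy ⟨by omega, by omega⟩, hcc', htt]
  · refine card_le_two_pow_of_branching M 0 (7 * M) (by omega) _ fun x hx y hy hne => ?_
    rw [Finset.mem_filter] at hx hy
    obtain ⟨t, ht, n, a, b, hn, he, hxa, hyb⟩ := h x hx.1 y hy.1 hne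
    obtain ⟨u, v, huv, hu, hv⟩ := he.readsAt
    refine ⟨t, t.zero_le, ht, fun j h0 hj => ?_, u, v, huv, hreads hxa hu, hreads hyb hv⟩
    rcases hn with hn | hn
    · exact absurd ⟨t, ht, a, fun j hj => he.eq_false (by omega), hxa⟩ hx.2
    -- At scale n ≥ M the agreement over the last 7n places reaches back to time 0, as t < 7M.
    · rw [hshift x t, hshift y t, hxa ⟨by omega, by omega⟩, hyb ⟨by omega, by omega⟩,
        he.eq_of_neg (by omega) (by omega)]

end Blocks

end

/-! ### The two factors and their metrics -/

noncomputable section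

section Spaces

/-- The intervals of integers that exhaust `ℤ`, starting with the support of a codeword. -/
def window (n : ℕ) : Set ℤ := Ico (-n) (n + 7)

theorem window_mono : Monotone window := fun _ _ h => Ico_subset_Ico (by omega) (by omega)

theorem iUnion_window : ⋃ n, window n = univ :=
  eq_univ_of_forall fun i => mem_iUnion.2 ⟨i.natAbs, by constructor <;> omega⟩

theorem not_eqOn_window_zero {a b : ℤ → Bool} {u v : ZMod 5} (huv : u ≠ v) (ha : ReadsAt a 0 u)
    (hb : ReadsAt b 0 v) : ¬ EqOn a b (window 0) := fun h =>
  huv ((ha.congr fun j h0 h7 => h ⟨by simpa using h0, by simpa using h7⟩).eq hb)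

/-- The pairs of sequences that are to be at distance 2. -/
def IsEdge (a b : ℤ → Bool) : Prop := ∃ k : ℕ, BlockEdge (200 ^ k) a b

/-- The distance of a pair of sequences from the set of edges. -/
def edgeDist (x y : ℤ → Bool) : ℝ :=
  ⨅ e : {e : (ℤ → Bool) × (ℤ → Bool) // IsEdge e.1 e.2},
    max (levelDist window x e.1.1) (levelDist window y e.1.2)

theorem IsEdge.symm {a b : ℤ → Bool} (h : IsEdge a b) : IsEdge b a := h.imp fun _ => .symm

instance : Nonempty {e : (ℤ → Bool) × (ℤ → Bool) // IsEdge e.1 e.2} := by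
  obtain ⟨p, -, hp⟩ := exists_blockEdge (m := 200 ^ 0) (w := fun _ => 0) (w' := fun _ => 1)
    ⟨0, by norm_num, by decide⟩
  exact ⟨⟨(_, _), 0, hp⟩⟩

theorem bddBelow_edgeDist (x y : ℤ → Bool) :
    BddBelow (range fun e : {e : (ℤ → Bool) × (ℤ → Bool) // IsEdge e.1 e.2} =>
      max (levelDist window x e.1.1) (levelDist window y e.1.2)) :=
  ⟨0, by rintro _ ⟨e, rfl⟩; exact le_max_of_le_left levelDist_nonneg⟩

theorem edgeDist_le {a b : ℤ → Bool} (h : IsEdge a b) (x y : ℤ → Bool) :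
    edgeDist x y ≤ max (levelDist window x a) (levelDist window y b) :=
  ciInf_le (bddBelow_edgeDist x y) ⟨(a, b), h⟩

theorem edgeDist_nonneg (x y : ℤ → Bool) : 0 ≤ edgeDist x y :=
  le_ciInf fun _ => le_max_of_le_left levelDist_nonneg

theorem edgeDist_le_one (x y : ℤ → Bool) : edgeDist x y ≤ 1 := by
  obtain ⟨⟨e, he⟩⟩ := (inferInstance : Nonempty {e : (ℤ → Bool) × (ℤ → Bool) // IsEdge e.1 e.2})
  exact (edgeDist_le he x y).trans (max_le levelDist_le_one levelDist_le_one)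

theorem edgeDist_comm (x y : ℤ → Bool) : edgeDist x y = edgeDist y x := by
  have h : ∀ x y, edgeDist x y ≤ edgeDist y x := fun x y =>
    le_ciInf fun e => (edgeDist_le e.2.symm x y).trans_eq (max_comm _ _)
  exact le_antisymm (h x y) (h y x)

theorem edgeDist_le_add (x y z : ℤ → Bool) :
    edgeDist z y ≤ edgeDist x y + levelDist window x z := by
  rw [← sub_le_iff_le_add]
  refine le_ciInf fun e => ?_
  rw [sub_le_iff_le_add]
  refine (edgeDist_le e.2 z y).trans (max_le ?_ ?_)
  · refine (levelDist_triangle (y := x)).trans ?_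
    rw [add_comm, levelDist_comm (x := z)]
    exact add_le_add_left (le_max_left _ _) _
  · exact (le_max_right _ _).trans (le_add_of_nonneg_right levelDist_nonneg)

open Classical in
/-- The distance on binary sequences: an ultrametric on sequences that agree on `window 0`, and
otherwise a distance between 1 and 2 that measures how close the two sequences are to an edge. -/
def seqDist (x y : ℤ → Bool) : ℝ :=
  if EqOn x y (window 0) then levelDist window x y else 2 - edgeDist x y

theorem seqDist_of_eqOn {x y : ℤ → Bool} (h : EqOn x y (window 0)) :
    seqDist x y = levelDist window x y := if_pos h

theorem seqDist_of_not_eqOn {x y : ℤ → Bool} (h : ¬ EqOn x y (window 0)) :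
    seqDist x y = 2 - edgeDist x y := if_neg h

theorem one_le_seqDist {x y : ℤ → Bool} (h : ¬ EqOn x y (window 0)) : 1 ≤ seqDist x y := by
  rw [seqDist_of_not_eqOn h]
  linarith [edgeDist_le_one x y]

theorem levelDist_le_seqDist (x y : ℤ → Bool) : levelDist window x y ≤ seqDist x y := by
  by_cases h : EqOn x y (window 0)
  · exact (seqDist_of_eqOn h).ge
  · exact levelDist_le_one.trans (one_le_seqDist h)

theorem seqDist_comm (x y : ℤ → Bool) : seqDist x y = seqDist y x := by
  by_cases h : EqOn x y (window 0)
  · rw [seqDist_of_eqOn h, seqDist_of_eqOn h.symm, levelDist_comm]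
  · rw [seqDist_of_not_eqOn h, seqDist_of_not_eqOn fun h' => h h'.symm, edgeDist_comm]

theorem seqDist_triangle_of_eqOn {x y z : ℤ → Bool} (hxy : ¬ EqOn x y (window 0))
    (hxz : EqOn x z (window 0)) : seqDist x y ≤ seqDist x z + seqDist z y := by
  rw [seqDist_of_not_eqOn hxy, seqDist_of_eqOn hxz,
    seqDist_of_not_eqOn fun h => hxy (hxz.trans h)]
  linarith [edgeDist_le_add x y z]

/-- If no two of the points agree on `window 0`, the bound is 2 ≤ 1 + 1. If one of the two steps
stays within a class of agreement, `edgeDist` changes by at most its length. -/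
theorem seqDist_triangle (x z y : ℤ → Bool) : seqDist x y ≤ seqDist x z + seqDist z y := by
  by_cases hxy : EqOn x y (window 0)
  · rw [seqDist_of_eqOn hxy]
    exact levelDist_triangle.trans
      (add_le_add (levelDist_le_seqDist x z) (levelDist_le_seqDist z y))
  by_cases hxz : EqOn x z (window 0)
  · exact seqDist_triangle_of_eqOn hxy hxz
  by_cases hzy : EqOn z y (window 0)
  · rw [seqDist_comm x y, add_comm, seqDist_comm x z, seqDist_comm z y]
    exact seqDist_triangle_of_eqOn (fun h => hxy h.symm) hzy.symm
  · rw [seqDist_of_not_eqOn hxy]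
    linarith [edgeDist_nonneg x y, one_le_seqDist hxz, one_le_seqDist hzy]

/-- Binary sequences with the distance `seqDist`. -/
def BinSeq : Type := ℤ → Bool

instance : MetricSpace BinSeq where
  dist := seqDist
  dist_self x := (seqDist_of_eqOn fun _ _ => rfl).trans levelDist_self
  dist_comm := seqDist_comm
  dist_triangle := seqDist_triangle
  eq_of_dist_eq_zero {x y} h :=
    eq_of_levelDist_eq_zero iUnion_window
      (le_antisymm ((levelDist_le_seqDist x y).trans_eq h) levelDist_nonneg)

theorem BinSeq.dist_le_of_eqOn {x y : BinSeq} {n : ℕ} (h : EqOn x y (window n)) :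
    dist x y ≤ (1 / 2) ^ (n + 1) :=
  (seqDist_of_eqOn (h.mono (window_mono n.zero_le))).trans_le
    ((levelDist_le_pow_iff window_mono).2 h)

theorem BinSeq.eqOn_of_dist_lt_one {x y : BinSeq} (h : dist x y < 1) : EqOn x y (window 0) := by
  by_contra hne
  exact not_lt.2 (one_le_seqDist hne) h

theorem BinSeq.two_le_dist {x y : BinSeq} (h : IsEdge x y) : 2 ≤ dist x y := by
  obtain ⟨k, hk⟩ := h
  obtain ⟨u, v, huv, hu, hv⟩ := hk.readsAt
  refine le_of_le_of_eq ?_ (seqDist_of_not_eqOn (not_eqOn_window_zero huv.ne hu hv)).symm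
  have : edgeDist x y ≤ 0 :=
    (edgeDist_le ⟨k, hk⟩ x y).trans (max_le levelDist_self.le levelDist_self.le)
  linarith

/-- Distance 2 means `edgeDist` zero; the infimum need not be attained, so edges only approximate
the pair. -/
theorem BinSeq.exists_edge_of_two_le_dist {x y : BinSeq} (h : 2 ≤ dist x y) (n : ℕ) :
    ∃ a b, IsEdge a b ∧ EqOn x a (window n) ∧ EqOn y b (window n) := by
  have hne : ¬ EqOn x y (window 0) := fun he => by
    have : dist x y ≤ 1 := (seqDist_of_eqOn he).trans_le levelDist_le_one
    linarith
  have hlt : edgeDist x y < (1 / 2) ^ n := by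
    have : dist x y = 2 - edgeDist x y := seqDist_of_not_eqOn hne
    have h2 : (0 : ℝ) < (1 / 2) ^ n := by positivity
    linarith
  obtain ⟨e, he⟩ := exists_lt_of_ciInf_lt hlt
  exact ⟨_, _, e.2, eqOn_of_levelDist_lt ((le_max_left _ _).trans_lt he),
    eqOn_of_levelDist_lt ((le_max_right _ _).trans_lt he)⟩

/-- The zero sequence is a centre of the space. -/
def BinSeq.zero : BinSeq := fun _ => false

theorem BinSeq.dist_zero_le_one (x : BinSeq) : dist BinSeq.zero x ≤ 1 := by
  by_cases h : EqOn BinSeq.zero x (window 0)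
  · exact (seqDist_of_eqOn h).trans_le levelDist_le_one
  · refine (seqDist_of_not_eqOn h).trans_le ?_
    -- Both sequences of an edge have a 1 at position 0, so neither is closer than 1 to the zero
    -- sequence.
    suffices 1 ≤ edgeDist BinSeq.zero x by linarith
    refine le_ciInf fun ⟨e, k, hk⟩ => le_max_of_le_left ?_
    by_contra! hlt
    obtain ⟨u, -, -, hu, -⟩ := hk.readsAt
    have h0 := (levelDist_lt_one_iff window_mono).1 hlt (show (0 : ℤ) ∈ window 0 by simp [window])
    have h1 := hu 0 le_rfl (by norm_num)
    rw [zero_add, ← h0] at h1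
    simp [BinSeq.zero, codeword] at h1

/-- The squares that exhaust `ℕ × ℤ`. -/
def square (n : ℕ) : Set (ℕ × ℤ) := {p | p.1 ≤ n ∧ |p.2| ≤ n}

theorem square_mono : Monotone square := fun m n h p hp =>
  ⟨hp.1.trans h, hp.2.trans (by exact_mod_cast h)⟩

theorem iUnion_square : ⋃ n, square n = univ :=
  eq_univ_of_forall fun p => mem_iUnion.2 ⟨p.1 + p.2.natAbs, by simp, by simp⟩

theorem finite_square (n : ℕ) : (square n).Finite := by
  refine ((finite_Iic n).prod (finite_Icc (-(n : ℤ)) n)).subset fun p hp => ?_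
  exact ⟨hp.1, abs_le.1 hp.2⟩

/-- Sequences of binary sequences, with an ultrametric. -/
def SeqTower : Type := ℕ × ℤ → Bool

instance : MetricSpace SeqTower where
  dist := levelDist square
  dist_self _ := levelDist_self
  dist_comm _ _ := levelDist_comm
  dist_triangle _ _ _ := levelDist_triangle
  eq_of_dist_eq_zero := eq_of_levelDist_eq_zero iUnion_square

theorem SeqTower.dist_le_one (x y : SeqTower) : dist x y ≤ 1 := levelDist_le_one

theorem SeqTower.eqOn_of_dist_lt {x y : SeqTower} {n : ℕ} (h : dist x y < (1 / 2) ^ n) :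
    EqOn x y (square n) := eqOn_of_levelDist_lt h

/-- The compact topology of `BinSeq` is that of a product. -/
def BinSeq.homeo : (ℤ → Bool) ≃ₜ BinSeq :=
  homeoOfFiniteAgreement (Equiv.refl _) fun ε hε => by
    obtain ⟨n, hn⟩ := exists_pow_lt_of_lt_one hε one_half_lt_one
    refine ⟨window n, finite_Ico _ _, fun x y h => (BinSeq.dist_le_of_eqOn h).trans_lt ?_⟩
    exact (pow_le_pow_of_le_one (by norm_num) (by norm_num) n.le_succ).trans_lt hn

/-- The compact topology of `SeqTower` is that of a product. -/
def SeqTower.homeo : (ℕ × ℤ → Bool) ≃ₜ SeqTower :=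
  homeoOfFiniteAgreement (Equiv.refl _) fun ε hε => by
    obtain ⟨n, hn⟩ := exists_pow_lt_of_lt_one hε one_half_lt_one
    refine ⟨square n, finite_square n, fun x y h =>
      ((levelDist_le_pow_iff square_mono).2 h).trans_lt ?_⟩
    exact (pow_le_pow_of_le_one (by norm_num) (by norm_num) n.le_succ).trans_lt hn

instance : CompactSpace BinSeq := BinSeq.homeo.compactSpace

instance : CompactSpace SeqTower := SeqTower.homeo.compactSpace

/-- The shift on `BinSeq`. -/
def BinSeq.shift (x : BinSeq) : BinSeq := shiftBy 1 x

theorem BinSeq.iterate_shift (t : ℕ) (x : BinSeq) : BinSeq.shift^[t] x = shiftBy t x := by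
  induction t generalizing x with
  | zero => funext i; simp [shiftBy]
  | succ t ih =>
    rw [Function.iterate_succ_apply, ih]
    funext i
    simp only [shiftBy, BinSeq.shift]
    congr 1
    push_cast
    ring

theorem BinSeq.isHomeomorph_shift : IsHomeomorph BinSeq.shift :=
  isHomeomorph_conj BinSeq.homeo (reindexHomeo (Equiv.addRight 1)) fun _ => rfl

/-- The map on `SeqTower` that acts on the `k`-th sequence as the `k`-th power of the shift. -/
def SeqTower.shift (y : SeqTower) : SeqTower := fun p => y (p.1, p.2 + p.1)

theorem SeqTower.iterate_shift (t : ℕ) (y : SeqTower) (k : ℕ) (i : ℤ) :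
    SeqTower.shift^[t] y (k, i) = y (k, i + t * k) := by
  induction t generalizing y with
  | zero => simp
  | succ t ih =>
    rw [Function.iterate_succ_apply, ih]
    simp only [SeqTower.shift]
    congr 2
    push_cast
    ring

theorem SeqTower.isHomeomorph_shift : IsHomeomorph SeqTower.shift :=
  isHomeomorph_conj SeqTower.homeo
    (reindexHomeo
      { toFun := fun p => (p.1, p.2 + p.1)
        invFun := fun p => (p.1, p.2 - p.1)
        left_inv := fun p => by simp
        right_inv := fun p => by simp }) fun _ => rfl

end Spaces

end

/-! ### Product system, homeomorphisms and transitivity -/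

noncomputable section

section System

/-- The product system. -/
def bigMap : BinSeq × SeqTower → BinSeq × SeqTower := Prod.map BinSeq.shift SeqTower.shift

/-- The zero point of `SeqTower`. -/
def SeqTower.zero : SeqTower := fun _ => false

/-- The sequences over the fixed point `0` of `SeqTower`. -/
def seqFiber : Set (BinSeq × SeqTower) := {p | p.2 = SeqTower.zero}

theorem SeqTower.shift_zero : SeqTower.shift SeqTower.zero = SeqTower.zero := rfl

theorem mapsTo_seqFiber : MapsTo bigMap seqFiber seqFiber := fun p (hp : p.2 = _) => by
  change SeqTower.shift p.2 = _
  rw [hp, SeqTower.shift_zero]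

theorem iterate_bigMap (t : ℕ) (p : BinSeq × SeqTower) :
    bigMap^[t] p = (shiftBy t p.1, SeqTower.shift^[t] p.2) := by
  rw [bigMap, Prod.map_iterate, ← BinSeq.iterate_shift]
  rfl

theorem isClosed_seqFiber : IsClosed seqFiber := isClosed_eq continuous_snd continuous_const

theorem isHomeomorph_bigMap : IsHomeomorph bigMap :=
  isHomeomorph_iff_continuous_bijective.2
    ⟨BinSeq.isHomeomorph_shift.continuous.prodMap SeqTower.isHomeomorph_shift.continuous,
      BinSeq.isHomeomorph_shift.bijective.prodMap SeqTower.isHomeomorph_shift.bijective⟩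

theorem isHomeomorph_restrict : IsHomeomorph (mapsTo_seqFiber.restrict bigMap seqFiber seqFiber) := by
  have : CompactSpace seqFiber := isCompact_iff_compactSpace.1 isClosed_seqFiber.isCompact
  refine isHomeomorph_iff_continuous_bijective.2
    ⟨isHomeomorph_bigMap.continuous.restrict mapsTo_seqFiber, ?_, ?_⟩
  · exact (mapsTo_seqFiber.restrict_inj).2 isHomeomorph_bigMap.injective.injOn
  · rintro ⟨⟨x, y⟩, hy : y = _⟩
    obtain ⟨x', rfl⟩ := BinSeq.isHomeomorph_shift.surjective x
    subst hy
    exact ⟨⟨(x', SeqTower.zero), rfl⟩, rfl⟩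

theorem not_isTopTransitive_bigMap : ¬ IsTopTransitive bigMap := by
  rintro ⟨p, hp⟩
  -- Level 0 of the tower never moves, so no orbit point agrees with `q` at (0, 0).
  let q : BinSeq × SeqTower := (BinSeq.zero, fun _ => !p.2 (0, 0))
  obtain ⟨_, ht, t, rfl⟩ := Metric.dense_iff.1 hp q 1 one_pos
  rw [Metric.mem_ball] at ht
  beta_reduce at ht
  rw [iterate_bigMap] at ht
  have h := SeqTower.eqOn_of_dist_lt (n := 0)
    (((le_max_right _ _).trans_lt ht).trans_eq (pow_zero _).symm)
    (show ((0, 0) : ℕ × ℤ) ∈ square 0 by simp [square])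
  change SeqTower.shift^[t] p.2 (0, 0) = !p.2 (0, 0) at h
  rw [SeqTower.iterate_shift] at h
  simp at h

/-- A sequence in which every finite word occurs: the dyadic interval that starts at `2 ^ s`
carries the binary digits of the first component of the pair that `s` encodes. -/
def universalSeq : BinSeq := fun i =>
  (Nat.unpair (Nat.log2 i.toNat)).1.testBit (i.toNat - 2 ^ Nat.log2 i.toNat)

theorem exists_eqOn_shift_universalSeq (x : BinSeq) (n : ℕ) :
    ∃ t : ℕ, EqOn (shiftBy t universalSeq) x (window n) := by
  let c := Nat.ofBits fun j : Fin (2 * n + 7) => x ((j : ℤ) - n)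
  -- Pairing the word with its length forces `s` to be at least that length, so the word fits into
  -- the dyadic interval.
  let s := Nat.pair c (2 * n + 7)
  have hs : 2 * n + 7 < 2 ^ s := (Nat.right_le_pair _ _).trans_lt Nat.lt_two_pow_self
  refine ⟨2 ^ s + n, fun i ⟨h1, h2⟩ => ?_⟩
  obtain ⟨j, hj⟩ : ∃ j : ℕ, i = (j : ℤ) - n := ⟨(i + n).toNat, by omega⟩
  subst hj
  have hj : j < 2 * n + 7 := by omega
  have h : ((j : ℤ) - n + (2 ^ s + n : ℕ)).toNat = 2 ^ s + j := by
    rw [show (j : ℤ) - n + (2 ^ s + n : ℕ) = ((2 ^ s + j : ℕ) : ℤ) by push_cast; ring]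
    exact Int.toNat_natCast _
  have hlog : Nat.log2 (2 ^ s + j) = s := by
    rw [Nat.log2_eq_iff (by positivity)]
    constructor
    · omega
    · rw [pow_succ]; omega
  change (Nat.unpair (Nat.log2 ((j : ℤ) - n + (2 ^ s + n : ℕ)).toNat)).1.testBit
    (((j : ℤ) - n + (2 ^ s + n : ℕ)).toNat -
      2 ^ Nat.log2 ((j : ℤ) - n + (2 ^ s + n : ℕ)).toNat) = x (j - n)
  rw [h, hlog, Nat.add_sub_cancel_left, Nat.unpair_pair]
  exact Nat.testBit_ofBits_lt _ _ hj

theorem isTopTransitive_restrict :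
    IsTopTransitive (mapsTo_seqFiber.restrict bigMap seqFiber seqFiber) := by
  have hmem : (universalSeq, SeqTower.zero) ∈ seqFiber := rfl
  have hiter : ∀ t : ℕ, (((mapsTo_seqFiber.restrict bigMap seqFiber seqFiber)^[t]
      ⟨(universalSeq, SeqTower.zero), hmem⟩ : seqFiber) : BinSeq × SeqTower) =
      (shiftBy t universalSeq, SeqTower.zero) := fun t => by
    rw [mapsTo_seqFiber.iterate_restrict, MapsTo.val_restrict_apply, iterate_bigMap,
      Function.iterate_fixed SeqTower.shift_zero]
  refine ⟨⟨(universalSeq, SeqTower.zero), hmem⟩, Metric.dense_iff.2 ?_⟩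
  rintro ⟨⟨x, y⟩, hy : y = _⟩ ε hε
  obtain ⟨n, hn⟩ := exists_pow_lt_of_lt_one hε one_half_lt_one
  obtain ⟨t, ht⟩ := exists_eqOn_shift_universalSeq x n
  refine ⟨_, ?_, t, rfl⟩
  rw [Metric.mem_ball, Subtype.dist_eq, hiter]
  subst hy
  refine (max_lt ?_ (by simpa using hε))
  exact ((BinSeq.dist_le_of_eqOn ht).trans
    (pow_le_pow_of_le_one (by norm_num) (by norm_num) n.le_succ)).trans_lt hn

end System

/-! ### Spanning rates and entropies -/

section Words

variable {ε : ℝ} {T : ℕ}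

theorem dist_iterate_zero_le_one (t : ℕ) (p : BinSeq × SeqTower) :
    dist (bigMap^[t] (BinSeq.zero, SeqTower.zero)) (bigMap^[t] p) ≤ 1 := by
  rw [iterate_bigMap, iterate_bigMap]
  exact max_le (BinSeq.dist_zero_le_one _) (SeqTower.dist_le_one _ _)

theorem spanNum_bigMap_eq_one {A : Set (BinSeq × SeqTower)}
    (hA : (BinSeq.zero, SeqTower.zero) ∈ A) (hε : 1 < ε) :
    spanNum A ε (dynDist bigMap T) = 1 :=
  spanNum_eq_one hA fun p _ => (dynDist_lt_iff (by linarith)).2 fun t _ =>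
    (dist_iterate_zero_le_one t p).trans_lt hε

theorem exists_covNum_seqFiber_le (hε : 0 < ε) :
    ∃ c : ℕ, ∀ T, covNum seqFiber ε (dynDist bigMap T) ≤ ((2 ^ (T + c) : ℕ) : ℕ∞) := by
  obtain ⟨n, hn⟩ := exists_pow_lt_of_lt_one hε one_half_lt_one
  -- The symbols on [-n, T + n + 7) determine `window n` at all times below `T`.
  refine ⟨2 * n + 7, fun T => (covNum_le_card
    (fun (p : BinSeq × SeqTower) (j : Fin (T + (2 * n + 7))) => p.1 ((j : ℤ) - n)) ?_).trans
      (by simp)⟩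
  rintro ⟨x, _⟩ (rfl : _ = SeqTower.zero) ⟨x', _⟩ (rfl : _ = SeqTower.zero) hxx
  refine (dynDist_lt_iff hε).2 fun t ht => ?_
  rw [iterate_bigMap, iterate_bigMap]
  refine max_lt ?_ (by simpa using hε)
  refine ((BinSeq.dist_le_of_eqOn fun i ⟨h1, h2⟩ => ?_).trans
    (pow_le_pow_of_le_one (by norm_num) (by norm_num) n.le_succ)).trans_lt hn
  have := congrFun hxx ⟨(i + t + n).toNat, by omega⟩
  simp only at this
  rwa [Int.toNat_of_nonneg (by omega), add_sub_cancel_right] at this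

/-- The point over `0` whose sequence starts with a given word. -/
def wordPoint (T : ℕ) (w : Fin T → Bool) : BinSeq × SeqTower :=
  (fun i => if h : i.toNat < T then w ⟨i.toNat, h⟩ else false, SeqTower.zero)

theorem wordPoint_eq_of_dist_lt (hε : ε ≤ 1) (hε' : 0 < ε) (s : BinSeq × SeqTower)
    (v w : Fin T → Bool) (hv : dynDist bigMap T s (wordPoint T v) < ε)
    (hw : dynDist bigMap T s (wordPoint T w) < ε) : v = w := by
  have key : ∀ u, dynDist bigMap T s (wordPoint T u) < ε → ∀ t : Fin T, s.1 t = u t := by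
    intro u hu t
    have h := (dynDist_lt_iff hε').1 hu t t.2
    rw [iterate_bigMap, iterate_bigMap] at h
    have := BinSeq.eqOn_of_dist_lt_one (((le_max_left _ _).trans_lt h).trans_le hε)
      (show (0 : ℤ) ∈ window 0 by simp [window])
    simpa [shiftBy, wordPoint] using this
  funext t
  rw [← key v hv, key w hw]

theorem two_pow_le_spanNum_seqFiber (hε : ε ≤ 1) (hε' : 0 < ε) (T : ℕ) :
    ((2 ^ T : ℕ) : ℕ∞) ≤ spanNum seqFiber ε (dynDist bigMap T) :=
  le_of_eq_of_le (by simp)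
    (card_le_spanNum (wordPoint T) (fun _ => rfl) (wordPoint_eq_of_dist_lt hε hε'))

theorem dynDist_self_lt (hε : 0 < ε) (p : BinSeq × SeqTower) : dynDist bigMap T p p < ε :=
  (dynDist_lt_iff hε).2 fun t _ => by simpa using hε

theorem two_pow_le_sepNum_seqFiber (hε : ε ≤ 1) (hε' : 0 < ε) (T : ℕ) :
    ((2 ^ T : ℕ) : ℕ∞) ≤ sepNum seqFiber ε (dynDist bigMap T) :=
  le_of_eq_of_le (by simp)
    (card_le_sepNum_of_span (wordPoint T) (fun _ => rfl) (dynDist_self_lt hε')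
      (wordPoint_eq_of_dist_lt hε hε'))

/-- The point over the zero sequence whose image in the `k`-th level of the tower starts, for
`1 ≤ k ≤ n`, with a given word spelled out along the multiples of `k`. -/
def towerPoint (n T : ℕ) (w : Fin n × Fin T → Bool) : BinSeq × SeqTower :=
  (BinSeq.zero, fun p =>
    if h : p.1 - 1 < n ∧ p.2.toNat / p.1 < T then w (⟨p.1 - 1, h.1⟩, ⟨p.2.toNat / p.1, h.2⟩)
    else false)

theorem towerPoint_eq_of_dist_lt {n : ℕ} (hε : ε ≤ (1 / 2) ^ n) (hε' : 0 < ε)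
    (s : BinSeq × SeqTower) (v w : Fin n × Fin T → Bool)
    (hv : dynDist bigMap T s (towerPoint n T v) < ε)
    (hw : dynDist bigMap T s (towerPoint n T w) < ε) : v = w := by
  -- Coordinate 0 of level k + 1 after t steps is coordinate t(k + 1). Level 0, where `towerPoint`
  -- takes a default index, is never read.
  have key : ∀ u, dynDist bigMap T s (towerPoint n T u) < ε →
      ∀ (k : Fin n) (t : Fin T), s.2 (k + 1, t * (k + 1)) = u (k, t) := by
    intro u hu k t
    have h := (dynDist_lt_iff hε').1 hu t t.2
    rw [iterate_bigMap, iterate_bigMap] at h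
    have h2 := SeqTower.eqOn_of_dist_lt (((le_max_right _ _).trans_lt h).trans_le hε)
      (show ((k + 1, 0) : ℕ × ℤ) ∈ square n by
        refine ⟨k.2, by simp⟩)
    change SeqTower.shift^[t] s.2 (k + 1, 0) =
      SeqTower.shift^[t] (towerPoint n T u).2 (k + 1, 0) at h2
    rw [SeqTower.iterate_shift, SeqTower.iterate_shift] at h2
    have h3 : (((t : ℕ) : ℤ) * (((k : ℕ) : ℤ) + 1)).toNat / ((k : ℕ) + 1) = t := by
      rw [← Nat.cast_succ, ← Nat.cast_mul, Int.toNat_natCast, Nat.succ_eq_add_one,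
        Nat.mul_div_cancel _ (Nat.succ_pos _)]
    simpa [towerPoint, h3] using h2
  funext ⟨k, t⟩
  rw [← key v hv, key w hw]

theorem two_pow_le_spanNum_univ {n : ℕ} (hε : ε ≤ (1 / 2) ^ n) (hε' : 0 < ε) (T : ℕ) :
    ((2 ^ (n * T) : ℕ) : ℕ∞) ≤ spanNum univ ε (dynDist bigMap T) :=
  le_of_eq_of_le (by simp)
    (card_le_spanNum (towerPoint n T) (fun _ => mem_univ _) (towerPoint_eq_of_dist_lt hε hε'))

theorem two_pow_le_sepNum_univ {n : ℕ} (hε : ε ≤ (1 / 2) ^ n) (hε' : 0 < ε) (T : ℕ) :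
    ((2 ^ (n * T) : ℕ) : ℕ∞) ≤ sepNum univ ε (dynDist bigMap T) :=
  le_of_eq_of_le (by simp)
    (card_le_sepNum_of_span (towerPoint n T) (fun _ => mem_univ _) (dynDist_self_lt hε')
      (towerPoint_eq_of_dist_lt hε hε'))

theorem tendsto_spanRate_of_one_lt {A : Set (BinSeq × SeqTower)}
    (hA : (BinSeq.zero, SeqTower.zero) ∈ A) (hε : 1 < ε) :
    Tendsto (spanRate bigMap A ε) atTop (𝓝 0) := by
  refine tendsto_const_nhds.congr fun T => ?_
  rw [spanRate, spanNum_bigMap_eq_one hA hε]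
  simp

theorem tendsto_spanRate_seqFiber (hε : ε ≤ 1) (hε' : 0 < ε) :
    Tendsto (spanRate bigMap seqFiber ε) atTop (𝓝 ((Real.log 2 : ℝ) : EReal)) := by
  obtain ⟨c, hc⟩ := exists_covNum_seqFiber_le hε'
  exact tendsto_log_div_of_two_pow c (two_pow_le_spanNum_seqFiber hε hε')
    fun T => spanNum_le_covNum.trans (hc T)

theorem tendsto_sepRate_seqFiber (hε : ε ≤ 1) (hε' : 0 < ε) :
    Tendsto (sepRate bigMap seqFiber ε) atTop (𝓝 ((Real.log 2 : ℝ) : EReal)) := by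
  obtain ⟨c, hc⟩ := exists_covNum_seqFiber_le hε'
  exact tendsto_log_div_of_two_pow c (two_pow_le_sepNum_seqFiber hε hε')
    fun T => sepNum_le_covNum.trans (hc T)

theorem tendsto_covRate_seqFiber (hε : ε ≤ 1) (hε' : 0 < ε) :
    Tendsto (covRate bigMap seqFiber ε) atTop (𝓝 ((Real.log 2 : ℝ) : EReal)) := by
  obtain ⟨c, hc⟩ := exists_covNum_seqFiber_le hε'
  exact tendsto_log_div_of_two_pow c
    (fun T => (two_pow_le_sepNum_seqFiber hε hε' T).trans sepNum_le_covNum) hc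

theorem hasTopEntropy_seqFiber : HasTopEntropy bigMap seqFiber ((Real.log 2 : ℝ) : EReal) := by
  have h : ∀ᶠ ε : ℝ in 𝓝[>] 0, 0 < ε ∧ ε ≤ 1 := Ioc_mem_nhdsGT one_pos
  refine ⟨?_, ?_, ?_⟩
  · exact tendsto_const_nhds.congr' (h.mono fun ε hε =>
      (tendsto_covRate_seqFiber hε.2 hε.1).limsup_eq.symm)
  · exact tendsto_const_nhds.congr' (h.mono fun ε hε =>
      (tendsto_sepRate_seqFiber hε.2 hε.1).limsup_eq.symm)
  · exact tendsto_const_nhds.congr' (h.mono fun ε hε =>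
      (tendsto_spanRate_seqFiber hε.2 hε.1).limsup_eq.symm)

theorem tendsto_limsup_top {N : ℝ → ℕ → ℕ∞}
    (h : ∀ (n : ℕ) (ε : ℝ), ε ≤ (1 / 2) ^ n → 0 < ε → ∀ T, ((2 ^ (n * T) : ℕ) : ℕ∞) ≤ N ε T) :
    Tendsto (fun ε : ℝ => limsup (fun T : ℕ => ENNReal.log (N ε T : ENNReal) / (T : EReal)) atTop)
      (𝓝[>] 0) (𝓝 ⊤) := by
  rw [EReal.tendsto_nhds_top_iff_real]
  intro M
  obtain ⟨n, hn⟩ := exists_nat_gt (M / Real.log 2)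
  rw [div_lt_iff₀ (Real.log_pos one_lt_two)] at hn
  filter_upwards [Ioc_mem_nhdsGT (show (0 : ℝ) < (1 / 2) ^ n by positivity)] with ε hε
  exact (EReal.coe_lt_coe_iff.2 hn).trans_le (le_limsup_log_div n (h n ε hε.2 hε.1))

theorem hasTopEntropy_univ : HasTopEntropy bigMap univ ⊤ :=
  ⟨tendsto_limsup_top fun _ _ h h' T => (two_pow_le_sepNum_univ h h' T).trans sepNum_le_covNum,
    tendsto_limsup_top fun _ _ h h' => two_pow_le_sepNum_univ h h',
    tendsto_limsup_top fun _ _ h h' => two_pow_le_spanNum_univ h h'⟩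

end Words

end

/-! ### Oscillation of the separation rate at resolution 2 -/

noncomputable section

section Oscillation

/-- The point over `0` whose sequence is the block sequence of a word. -/
def blockPoint (m : ℕ) (w : Fin (4 * m) → ZMod 5) : BinSeq × SeqTower :=
  (blockSeq m fun i => if h : i < 4 * m then w ⟨i, h⟩ else 0, SeqTower.zero)

theorem two_le_dynDist_blockPoint (k : ℕ) {v w : Fin (4 * 200 ^ k) → ZMod 5} (h : v ≠ w) :
    2 ≤ dynDist bigMap (63 * 200 ^ k) (blockPoint (200 ^ k) v) (blockPoint (200 ^ k) w) := by
  obtain ⟨i, hi⟩ := Function.ne_iff.1 h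
  obtain ⟨p, hp, he⟩ := exists_blockEdge (m := 200 ^ k)
    (w := fun i => if h : i < 4 * 200 ^ k then v ⟨i, h⟩ else 0)
    (w' := fun i => if h : i < 4 * 200 ^ k then w ⟨i, h⟩ else 0)
    ⟨i, i.2, by simpa using hi⟩
  refine (le_dynDist_iff two_pos).2 ⟨p, hp, ?_⟩
  rw [iterate_bigMap, iterate_bigMap]
  exact le_max_of_le_left (BinSeq.two_le_dist ⟨k, he⟩)

theorem le_sepNum_seqFiber (k : ℕ) :
    ((5 ^ (4 * 200 ^ k) : ℕ) : ℕ∞) ≤ sepNum seqFiber 2 (dynDist bigMap (63 * 200 ^ k)) := by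
  refine le_of_eq_of_le (by simp [ZMod.card])
    (card_le_sepNum (blockPoint (200 ^ k)) (fun _ => rfl) (fun v w hvw => ?_)
      fun v w => two_le_dynDist_blockPoint k)
  by_contra hne
  have := two_le_dynDist_blockPoint k hne
  rw [hvw] at this
  exact absurd this (not_le.2 (dynDist_self_lt two_pos _))

theorem scale_bound (k : ℕ) :
    7 * 200 ^ (k + 1) * 2 ^ (126 * 200 ^ k) + 2 ^ 200 ^ (k + 1) ≤ 2 ^ (200 ^ (k + 1) + 1) := by
  have h1 : 1 ≤ 200 ^ k := Nat.one_le_pow _ _ (by norm_num)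
  have h2 : 200 ^ (k + 1) = 200 * 200 ^ k := by ring
  rw [h2]
  generalize 200 ^ k = m at *
  -- The ratio 200 of scales is 126 + 74: the remaining 74m bits absorb the factor counting times.
  have h3 : 7 * (200 * m) ≤ 2 ^ (74 * m) := calc
    7 * (200 * m) = 1400 * m := by ring
    _ ≤ 2 ^ 11 * 2 ^ m := Nat.mul_le_mul (by norm_num) Nat.lt_two_pow_self.le
    _ = 2 ^ (11 + m) := (pow_add _ _ _).symm
    _ ≤ 2 ^ (74 * m) := Nat.pow_le_pow_right (by norm_num) (by omega)
  calc 7 * (200 * m) * 2 ^ (126 * m) + 2 ^ (200 * m)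
      ≤ 2 ^ (74 * m) * 2 ^ (126 * m) + 2 ^ (200 * m) := by gcongr
    _ = 2 ^ (200 * m + 1) := by rw [← pow_add, ← add_mul, pow_succ]; ring

theorem sepNum_univ_le (k : ℕ) :
    sepNum univ 2 (dynDist bigMap (7 * 200 ^ (k + 1))) ≤ ((2 ^ (200 ^ (k + 1) + 1) : ℕ) : ℕ∞) := by
  classical
  refine iSup₂_le fun S hS => Nat.cast_le.2 ?_
  have hsep : ∀ p ∈ S, ∀ q ∈ S, p ≠ q → ∃ t < 7 * 200 ^ (k + 1),
      2 ≤ dist (α := BinSeq) (shiftBy (t : ℕ) p.1) (shiftBy (t : ℕ) q.1) := by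
    intro p hp q hq hne
    obtain ⟨t, ht, hd⟩ := (le_dynDist_iff two_pos).1 (hS.2 p hp q hq hne)
    rw [iterate_bigMap, iterate_bigMap] at hd
    refine ⟨t, ht, (le_max_iff.1 hd).resolve_right fun h => ?_⟩
    exact absurd (h.trans (SeqTower.dist_le_one _ _)) (by norm_num)
  have hinj : InjOn Prod.fst (S : Set (BinSeq × SeqTower)) := by
    intro p hp q hq hpq
    by_contra hne
    obtain ⟨t, -, hd⟩ := hsep p hp q hq hne
    rw [hpq] at hd
    exact absurd (hd.trans_eq (dist_self (α := BinSeq) _)) (by norm_num)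
  rw [← Finset.card_image_of_injOn hinj]
  refine le_trans ?_ (scale_bound k)
  have hmain := card_le_of_blockEdges (200 ^ k) (200 ^ (k + 1)) (S.image Prod.fst) ?_
  · exact hmain
  intro x hx y hy hne
  obtain ⟨p, hp, rfl⟩ := Finset.mem_image.1 hx
  obtain ⟨q, hq, rfl⟩ := Finset.mem_image.1 hy
  obtain ⟨t, ht, hd⟩ := hsep p hp q hq fun h => hne (h ▸ rfl)
  obtain ⟨a, b, ⟨j, hj⟩, ha, hb⟩ :=
    BinSeq.exists_edge_of_two_le_dist hd (7 * 200 ^ (k + 1) + 7)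
  have hsub : Ico (-(7 * ((200 ^ (k + 1) : ℕ) : ℤ) + 7)) (7 * ((200 ^ (k + 1) : ℕ) : ℤ) + 7) ⊆
      window (7 * 200 ^ (k + 1) + 7) :=
    Ico_subset_Ico (by push_cast; linarith) (by push_cast; linarith)
  refine ⟨t, ht, 200 ^ j, a, b, ?_, hj, ha.mono hsub, hb.mono hsub⟩
  -- No scale lies strictly between 200^k and 200^(k+1).
  exact (Nat.lt_or_ge k j).symm.imp (fun h => Nat.pow_le_pow_right (by norm_num) h)
    fun h => Nat.pow_le_pow_right (by norm_num) h

theorem tendsto_mul_two_hundred_pow {c : ℕ} (hc : 0 < c) :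
    Tendsto (fun k : ℕ => c * 200 ^ k) atTop atTop :=
  (tendsto_pow_atTop_atTop_of_one_lt (by norm_num)).const_mul_atTop' hc

theorem le_limsup_sepRate : ((4 * Real.log 5 / 63 : ℝ) : EReal) ≤
    limsup (sepRate bigMap seqFiber 2) atTop := by
  refine le_limsup_of_frequently_le ?_
  refine (tendsto_mul_two_hundred_pow (c := 63) (by norm_num)).frequently
    (Eventually.frequently (Eventually.of_forall fun k => ?_))
  have : 4 * Real.log 5 / 63 =
      Real.log ((5 ^ (4 * 200 ^ k) : ℕ) : ℝ) / ((63 * 200 ^ k : ℕ) : ℝ) := by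
    push_cast
    rw [Real.log_pow]
    push_cast
    field_simp
  exact this ▸ le_log_div (by positivity) (le_sepNum_seqFiber k)

theorem liminf_sepRate_le {c : ℝ} (hc : Real.log 2 / 7 < c) :
    liminf (sepRate bigMap univ 2) atTop ≤ (c : EReal) := by
  refine liminf_le_of_frequently_le ?_
  have hlim : Tendsto (fun k : ℕ => Real.log 2 / 7 +
      Real.log 2 / ((7 * 200 ^ k : ℕ) : ℝ)) atTop (𝓝 (Real.log 2 / 7 + 0)) :=
    tendsto_const_nhds.add ((tendsto_const_div_atTop_nhds_zero_nat _).comp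
      (tendsto_mul_two_hundred_pow (c := 7) (by norm_num)))
  rw [add_zero] at hlim
  refine (tendsto_mul_two_hundred_pow (c := 7) (by norm_num)).frequently
    (Eventually.frequently ?_)
  filter_upwards [hlim.eventually_le_const hc, eventually_ge_atTop 1] with k hk hk1
  obtain ⟨k, rfl⟩ := Nat.exists_eq_add_of_le' hk1
  refine (log_div_le (by positivity) (sepNum_univ_le k)).trans (EReal.coe_le_coe_iff.2 ?_)
  refine le_of_eq_of_le ?_ hk
  push_cast
  rw [Real.log_pow]
  push_cast
  field_simp

theorem log_two_div_lt_log_five_div : Real.log 2 / 7 < 4 * Real.log 5 / 63 := by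
  have h : Real.log ((2 : ℝ) ^ 9) < Real.log ((5 : ℝ) ^ 4) :=
    Real.log_lt_log (by norm_num) (by norm_num)
  rw [Real.log_pow, Real.log_pow] at h
  push_cast at h
  linarith

/-- The upper bound holds on the whole space and the lower bound on the fibre, so monotonicity
covers every set between them. -/
theorem liminf_sepRate_lt_limsup {A : Set (BinSeq × SeqTower)} (hA : seqFiber ⊆ A) :
    liminf (sepRate bigMap A 2) atTop < limsup (sepRate bigMap A 2) atTop := by
  obtain ⟨c, hc, hc'⟩ := exists_between log_two_div_lt_log_five_div
  calc liminf (sepRate bigMap A 2) atTop ≤ liminf (sepRate bigMap univ 2) atTop :=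
        liminf_le_liminf (Eventually.of_forall fun T => log_div_mono (sepNum_mono (subset_univ A)) T)
    _ ≤ (c : EReal) := liminf_sepRate_le hc
    _ < ((4 * Real.log 5 / 63 : ℝ) : EReal) := EReal.coe_lt_coe_iff.2 hc'
    _ ≤ limsup (sepRate bigMap seqFiber 2) atTop := le_limsup_sepRate
    _ ≤ limsup (sepRate bigMap A 2) atTop :=
        limsup_le_limsup (Eventually.of_forall fun T => log_div_mono (sepNum_mono hA) T)

end Oscillation

end

theorem theorem2 :
    ∃ (X : Type) (_ : MetricSpace X) (F : X → X) (W : Set X) (hW : MapsTo F W W),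
      -- compactness, and both maps are homeomorphisms
      (CompactSpace X ∧ IsCompact W ∧
        IsHomeomorph F ∧ IsHomeomorph (hW.restrict F W W)) ∧
      (∃ ε : ℝ, 0 < ε ∧
        -- separation numbers at resolution ε
        (liminf (sepRate F univ ε) atTop < limsup (sepRate F univ ε) atTop ∧
          liminf (sepRate F W ε) atTop < limsup (sepRate F W ε) atTop) ∧
        -- spanning numbers at all resolutions
        (∀ δ : ℝ, 0 < δ → liminf (spanRate F W δ) atTop = limsup (spanRate F W δ) atTop) ∧
        (∃ δstar : ℝ, 0 < δstar ∧ δstar < ε ∧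
          (∀ δ : ℝ, δstar < δ →
            Tendsto (spanRate F univ δ) atTop (𝓝 0) ∧
              Tendsto (spanRate F W δ) atTop (𝓝 0)) ∧
          (∀ δ : ℝ, 0 < δ → δ ≤ δstar →
            Tendsto (spanRate F W δ) atTop (𝓝 ((Real.log 2 : ℝ) : EReal))))) ∧
      -- entropies
      (HasTopEntropy F univ ⊤ ∧ HasTopEntropy F W ((Real.log 2 : ℝ) : EReal)) ∧
      -- transitivity
      (¬ IsTopTransitive F ∧ IsTopTransitive (hW.restrict F W W)) := by
  have hzero : (BinSeq.zero, SeqTower.zero) ∈ seqFiber := rfl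
  refine ⟨BinSeq × SeqTower, inferInstance, bigMap, seqFiber, mapsTo_seqFiber,
    ⟨inferInstance, isClosed_seqFiber.isCompact, isHomeomorph_bigMap, isHomeomorph_restrict⟩,
    ⟨2, two_pos, ⟨liminf_sepRate_lt_limsup (subset_univ _), liminf_sepRate_lt_limsup subset_rfl⟩,
      fun δ hδ => ?_, 1, one_pos, one_lt_two, fun δ hδ =>
        ⟨tendsto_spanRate_of_one_lt (mem_univ _) hδ, tendsto_spanRate_of_one_lt hzero hδ⟩,
      fun δ h0 h1 => tendsto_spanRate_seqFiber h1 h0⟩,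
    ⟨hasTopEntropy_univ, hasTopEntropy_seqFiber⟩,
    not_isTopTransitive_bigMap, isTopTransitive_restrict⟩
  rcases le_or_gt δ 1 with h1 | h1
  · have h := tendsto_spanRate_seqFiber h1 hδ
    rw [h.liminf_eq, h.limsup_eq]
  · have h := tendsto_spanRate_of_one_lt hzero h1
    rw [h.liminf_eq, h.limsup_eq]
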